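/- **Setting.** For $n\ge 1$ and $\boldsymbol d=(d_1,\dots,d_n)\in\mathbb{Z}_{\ge 0}^n$, the configuration model $\mathrm{CM}_n(\boldsymbol d)$ is the random multigraph on $[n]=\{1,\dots,n\}$ obtained by attaching $d_i$ half-edges to each vertex $i$ and pairing all half-edges uniformly at random, each pair forming an edge; if $\mathcal L_n=\sum_{i\in[n]}d_i$ is odd, one extra half-edge is first added to vertex $n$. Let $u,v$ be uniform vertices in $[n]$, independent of each other and of the pairing. Let $\mathcal D_n(u,v)$ be the minimal number of edges on a path between $u$ and $v$ ($\infty$ if there is none), and let $F_n(x)=\frac1n\#\{i\in[n]: d_i\le x\}$. **Proposition (Upper tightness of graph distances).** Let $\tau\in(2,3)$, $\gamma\in(0,1)$, $C\in\mathbb R$, $c,\beta,x_0>0$ and $\alpha>1/2$. For $n\ge1$, let $\mathcal A_n$ be the set of degree sequences $\boldsymbol d=(d_1,\dots,d_n)$ with $\mathcal L_n\le \beta n$ and $$1-F_n(x)\ \ge\ \frac{c}{x^{\tau-1-C(\log x)^{\gamma-1}}}\qquad\text{for all } x\in[x_0,n^\alpha)\text{ with }x>1 .$$ Then for every $\varepsilon>0$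 there exists $k\in\mathbb N$, depending only on $\varepsilon$ and on $\tau,\gamma,C,c,\beta,x_0,\alpha$, such that $$\sup_{n\ge1}\ \sup_{\boldsymbol d\in\mathcal A_n}\ \mathbb P\Big(\mathcal D_n(u,v)-\frac{2\log\log n}{|\log(\tau-2)|}\ge 1\ \Big|\ d_u\ge k,\ d_v\ge k\Big)<\varepsilon ,$$ and the same holds, with the same $k$, when one conditions in addition on $u$ and $v$ being in the same connected component. Here a conditional probability given an event of probability zero (no vertex of degree at least $k$) is read as $0$, and for $n=1$, where $u=v$ and $\mathcal D_1(u,v)=0$, the event is read as empty. -/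

import Mathlib

open scoped ENNReal

namespace ConfigurationModel

/-- The degrees actually used to build the graph: if the total degree is odd, one extra half-edge
is given to the last vertex; otherwise nothing is changed. -/
def evenDegrees {n : ℕ} (d : Fin n → ℕ) (v : Fin n) : ℕ :=
  d v + if (v : ℕ) + 1 = n then (∑ w, d w) % 2 else 0

/-- The half-edges: `⟨v, j⟩` is the `j`-th half-edge attached to the vertex `v`. -/
abbrev HalfEdge {n : ℕ} (d : Fin n → ℕ) : Type :=
  Σ v : Fin n, Fin (evenDegrees d v)

/-- A pairing (perfect matching) of the half-edges, given by the map that sends each half-edge to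
its partner: an involution without fixed points. -/
def Pairing {n : ℕ} (d : Fin n → ℕ) : Type :=
  {σ : Equiv.Perm (HalfEdge d) // ∀ h, σ h ≠ h ∧ σ (σ h) = h}

instance {n : ℕ} (d : Fin n → ℕ) : Finite (Pairing d) :=
  inferInstanceAs (Finite {σ : Equiv.Perm (HalfEdge d) // ∀ h, σ h ≠ h ∧ σ (σ h) = h})

instance {n : ℕ} (d : Fin n → ℕ) : MeasurableSpace (Pairing d) := ⊤

/-- The adjacency structure of the multigraph obtained from a pairing: distinct vertices `u`, `v`
are adjacent iff some half-edge of `u` is paired to some half-edge of `v`. Self-loops and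
multiplicities of edges are forgotten; they influence neither graph distances nor components. -/
def graph {n : ℕ} {d : Fin n → ℕ} (σ : Pairing d) : SimpleGraph (Fin n) where
  Adj u v := u ≠ v ∧ ∃ h : HalfEdge d, h.1 = u ∧ (σ.1 h).1 = v
  symm := ⟨by
    rintro u v ⟨huv, h, hu, hv⟩
    exact ⟨huv.symm, σ.1 h, hv, by rw [(σ.2 h).2]; exact hu⟩⟩
  loopless := ⟨fun _ h => h.1 rfl⟩

/-- The sample space: a pairing `ω.1` of the half-edges and two vertices `u = ω.2.1`,
`v = ω.2.2`. -/
abbrev Sample {n : ℕ} (d : Fin n → ℕ) : Type := Pairing d × Fin n × Fin n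

/-- The uniform distribution on the finite sample space: the half-edges are paired uniformly at
random, and `u`, `v` are uniform vertices, independent of each other and of the pairing. -/
noncomputable def law {n : ℕ} (d : Fin n → ℕ) : MeasureTheory.Measure (Sample d) :=
  ProbabilityTheory.uniformOn Set.univ

/-- The graph distance `𝒟ₙ(u, v)`; it is `⊤` if `u` and `v` lie in different components. -/
noncomputable def graphDist {n : ℕ} {d : Fin n → ℕ} (ω : Sample d) : ℕ∞ :=
  (graph ω.1).edist ω.2.1 ω.2.2

/-- The event `d_u ≥ k, d_v ≥ k`. -/
def highDegrees {n : ℕ} (d : Fin n → ℕ) (k : ℕ) : Set (Sample d) :=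
  {ω | k ≤ d ω.2.1 ∧ k ≤ d ω.2.2}

/-- The event that `u` and `v` lie in the same connected component. -/
def sameComponent {n : ℕ} (d : Fin n → ℕ) : Set (Sample d) :=
  {ω | (graph ω.1).Reachable ω.2.1 ω.2.2}

/-- The event `𝒟ₙ(u, v) - 2 log log n / |log (τ - 2)| ≥ 1`, with values in the extended reals
because `𝒟ₙ(u, v)` may be infinite. -/
def farApart {n : ℕ} (d : Fin n → ℕ) (τ : ℝ) : Set (Sample d) :=
  {ω | (((graphDist ω : ℕ∞) : ℝ≥0∞) : EReal)
      - ((2 * Real.log (Real.log n) / |Real.log (τ - 2)| : ℝ) : EReal) ≥ 1}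

/-- The empirical distribution function `Fₙ(x) = #{v : d_v ≤ x} / n`. -/
noncomputable def empiricalCDF {n : ℕ} (d : Fin n → ℕ) (x : ℝ) : ℝ :=
  (Nat.card {v : Fin n // (d v : ℝ) ≤ x} : ℝ) / n

/-- The assumption on a degree sequence of length `n`: the total degree is at most `n β`, and the
empirical tail is at least `c / x ^ (τ - 1 - C (log x) ^ (γ - 1))` for all `x ∈ [x₀, n ^ α)`
(where `x > 1`, so that the expression makes sense). -/
structure Admissible (τ γ C c β x₀ α : ℝ) {n : ℕ} (d : Fin n → ℕ) : Prop where
  total_le : ((∑ v, d v : ℕ) : ℝ) ≤ n * β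
  tail_ge : ∀ x : ℝ, 1 < x → x₀ ≤ x → x < (n : ℝ) ^ α →
    1 - empiricalCDF d x ≥ c / x ^ (τ - 1 - C * Real.log x ^ (γ - 1))

end ConfigurationModel

namespace ConfigurationModel

/-! Put s = 1/(τ-2) > 1. Vertices of degree at least e^b carry at least c n exp(-(τ-2)b + C b^γ)
half-edges, out of at most (β+1)n. A vertex of degree e^a therefore expects about exp(a - b/s + C
b^γ) neighbours among them, which is large even for b close to s a. So the log-degree can be
multiplied by almost s at each step, and fewer than log log n / log s steps lead from a large
constant degree to a hub of degree n^μ with μ > 1/2. Any two hubs are adjacent except with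
probability exp(-const n^(2μ-1)), which survives a union bound over n² pairs (`card_not_adj_le`).
Climbing from both ends and joining the hubs gives distance at most 2K+1 (`card_far_le`).

Exactly K steps must suffice, so the loss from b^γ cannot accumulate. `exists_layer_exponents`
starts the log-degrees at twice the base value and spends this surplus gradually. The failure
probabilities are then summable, with a sum made small by a large initial degree.

The randomness is handled by revealing pairs one at a time. A conditional bound reads "the bad
matchings in E number at most b times those in E", with E a cylinder, so empty events need no
separate treatment. `IsCylinder.card_le_of_reveal` is one reveal, `IsCylinder.card_le_of_trials`
repeats it at one vertex, and `card_not_nearHub_le` iterates over layers.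

Conditioning on a common component costs a factor 2, since disconnected pairs already count as far
apart. -/

/-- Perfect matchings of a type, as fixed-point-free involutions. -/
abbrev Matching (H : Type*) : Type _ := {σ : Equiv.Perm H // ∀ h, σ h ≠ h ∧ σ (σ h) = h}

noncomputable instance (H : Type*) [Finite H] : Fintype (Matching H) := Fintype.ofFinite _

/-! ### Exploring a uniform matching pair by pair -/

section Matching

variable {H : Type*}

/-- `E` is a set of matchings that match `A` with itself, and membership in `E` depends only on how
`A` is matched. -/
structure IsCylinder (A : Finset H) (E : Finset (Matching H)) : Prop where
  closed : ∀ σ ∈ E, ∀ a ∈ A, σ.1 a ∈ A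
  mem_of_eqOn : ∀ σ ∈ E, ∀ ρ : Matching H, (∀ a ∈ A, ρ.1 a = σ.1 a) → ρ ∈ E

/-- The conjugate of a matching by a transposition. -/
def Matching.swapConj [DecidableEq H] (x y : H) (σ : Matching H) : Matching H :=
  ⟨Equiv.swap x y * σ.1 * Equiv.swap x y, fun h => by
    constructor
    · intro e
      apply (σ.2 (Equiv.swap x y h)).1
      have := congrArg (Equiv.swap x y) e
      simpa using this
    · simp [(σ.2 _).2]⟩

theorem Matching.swapConj_apply [DecidableEq H] (x y : H) (σ : Matching H) (h : H) :
    (σ.swapConj x y).1 h = Equiv.swap x y (σ.1 (Equiv.swap x y h)) := rfl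

theorem Matching.swapConj_injective [DecidableEq H] (x y : H) :
    Function.Injective (Matching.swapConj x y) := by
  intro σ ρ e
  apply Subtype.ext
  have := congrArg Subtype.val e
  simpa [Matching.swapConj] using this

theorem Matching.apply_eq_comm (σ : Matching H) {a b : H} : σ.1 a = b ↔ σ.1 b = a :=
  ⟨fun e => by rw [← e, (σ.2 a).2], fun e => by rw [← e, (σ.2 b).2]⟩

variable [DecidableEq H]

theorem IsCylinder.fiber {A : Finset H} {E : Finset (Matching H)} (hE : IsCylinder A E)
    (h h' : H) :
    IsCylinder (insert h (insert h' A)) (E.filter fun σ => σ.1 h = h') := by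
  constructor
  · intro σ hσ a ha
    obtain ⟨hσE, hσh⟩ := Finset.mem_filter.1 hσ
    simp only [Finset.mem_insert] at ha ⊢
    rcases ha with rfl | rfl | ha
    · exact Or.inr (Or.inl hσh)
    · exact Or.inl (σ.apply_eq_comm.1 hσh)
    · exact Or.inr (Or.inr (hE.closed σ hσE a ha))
  · intro σ hσ ρ hρ
    obtain ⟨hσE, hσh⟩ := Finset.mem_filter.1 hσ
    refine Finset.mem_filter.2 ⟨hE.mem_of_eqOn σ hσE ρ fun a ha => hρ a (by simp [ha]), ?_⟩
    rw [hρ h (by simp), hσh]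

/-- Conjugation by the transposition of `x` and `y` injects one fiber into the other: both are
unrevealed, so the matching on `A` does not change and the result stays in `E`. Used in both
directions, this makes the partner of `h` uniform. -/
theorem IsCylinder.card_fiber_le {A : Finset H} {E : Finset (Matching H)} (hE : IsCylinder A E)
    {h x y : H} (hxA : x ∉ A) (hyA : y ∉ A) (hx : x ≠ h) (hy : y ≠ h) :
    (E.filter fun σ => σ.1 h = x).card ≤ (E.filter fun σ => σ.1 h = y).card := by
  refine Finset.card_le_card_of_injOn (Matching.swapConj x y) ?_
    (Matching.swapConj_injective x y).injOn
  intro σ hσ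
  obtain ⟨hσE, hσh⟩ := Finset.mem_filter.1 hσ
  have key : ∀ a ∈ A, Equiv.swap x y a = a := fun a ha =>
    Equiv.swap_apply_of_ne_of_ne (fun e => hxA (e ▸ ha)) (fun e => hyA (e ▸ ha))
  refine Finset.mem_coe.2 (Finset.mem_filter.2 ⟨hE.mem_of_eqOn σ hσE _ fun a ha => ?_, ?_⟩)
  · rw [Matching.swapConj_apply, key a ha, key _ (hE.closed σ hσE a ha)]
  · rw [Matching.swapConj_apply, Equiv.swap_apply_of_ne_of_ne hx.symm hy.symm, hσh,
      Equiv.swap_apply_left]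

variable [Fintype H]

/-- Reveal the partner of one free half-edge `h`: it is uniform over the other free half-edges. -/
theorem IsCylinder.card_le_of_reveal {A : Finset H} {E : Finset (Matching H)}
    (hE : IsCylinder A E) {h : H} (hh : h ∉ A) (F : Matching H → Prop) [DecidablePred F] {T : Finset H} {p b b' : ℝ}
    (hTA : Disjoint T (insert h A)) (hp : p * Fintype.card H ≤ T.card) (hp0 : 0 ≤ p)
    (hbb : b ≤ b')
    (hT : ∀ h' ∈ T, (((E.filter fun σ => σ.1 h = h').filter F).card : ℝ)
      ≤ b * (E.filter fun σ => σ.1 h = h').card)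
    (hT' : ∀ h', h' ∉ A → h' ≠ h → (((E.filter fun σ => σ.1 h = h').filter F).card : ℝ)
      ≤ b' * (E.filter fun σ => σ.1 h = h').card) :
    ((E.filter F).card : ℝ) ≤ (b + (1 - p) * (b' - b)) * E.card := by
  set Q : Finset H := (insert h A)ᶜ with hQ
  have hTQ : T ⊆ Q := by
    intro x hx
    rw [hQ, Finset.mem_compl]
    exact Finset.disjoint_left.1 hTA hx
  have hQmem : ∀ x, x ∈ Q ↔ x ≠ h ∧ x ∉ A := by
    intro x; simp [hQ]
  have hmaps : ∀ σ ∈ E, σ.1 h ∈ Q := by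
    intro σ hσ
    rw [hQmem]
    refine ⟨(σ.2 h).1, fun hA => hh ?_⟩
    have := hE.closed σ hσ _ hA
    rwa [(σ.2 h).2] at this
  have hEsum : (E.card : ℝ) = ∑ x ∈ Q, ((E.filter fun σ => σ.1 h = x).card : ℝ) := by
    rw [Finset.card_eq_sum_card_fiberwise (f := fun σ : Matching H => σ.1 h) (t := Q) hmaps]
    push_cast; rfl
  have hFsum : ((E.filter F).card : ℝ)
      = ∑ x ∈ Q, (((E.filter fun σ => σ.1 h = x).filter F).card : ℝ) := by
    rw [Finset.card_eq_sum_card_fiberwise (f := fun σ : Matching H => σ.1 h) (t := Q)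
      (fun σ hσ => hmaps σ (Finset.mem_filter.1 hσ).1)]
    push_cast
    refine Finset.sum_congr rfl fun x _ => ?_
    rw [Finset.filter_filter, Finset.filter_filter]
    simp only [and_comm]
  rcases Q.eq_empty_or_nonempty with hQe | ⟨q, hq⟩
  · rw [hFsum, hEsum, hQe]; simp
  set e : ℝ := ((E.filter fun σ => σ.1 h = q).card : ℝ) with he
  have hconst : ∀ x ∈ Q, ((E.filter fun σ => σ.1 h = x).card : ℝ) = e := by
    intro x hx
    obtain ⟨hx1, hx2⟩ := (hQmem x).1 hx
    obtain ⟨hq1, hq2⟩ := (hQmem q).1 hq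
    rw [he]
    exact_mod_cast le_antisymm (hE.card_fiber_le hx2 hq2 hx1 hq1)
      (hE.card_fiber_le hq2 hx2 hq1 hx1)
  have hE' : (E.card : ℝ) = Q.card * e := by
    rw [hEsum, Finset.sum_congr rfl hconst, Finset.sum_const, nsmul_eq_mul]
  have he0 : 0 ≤ e := by rw [he]; positivity
  have hF' : ((E.filter F).card : ℝ) ≤ T.card * (b * e) + (Q.card - T.card) * (b' * e) := by
    rw [hFsum, ← Finset.sum_sdiff hTQ, add_comm]
    refine add_le_add ?_ ?_
    · rw [← nsmul_eq_mul]
      refine Finset.sum_le_card_nsmul _ _ _ fun x hx => ?_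
      have := hT x hx
      rwa [hconst x (hTQ hx)] at this
    · have hc : ((Q \ T).card : ℝ) = Q.card - T.card := by
        rw [Finset.card_sdiff_of_subset hTQ, Nat.cast_sub (Finset.card_le_card hTQ)]
      rw [← hc, ← nsmul_eq_mul]
      refine Finset.sum_le_card_nsmul _ _ _ fun x hx => ?_
      have hxQ := (Finset.mem_sdiff.1 hx).1
      have := hT' x ((hQmem x).1 hxQ).2 ((hQmem x).1 hxQ).1
      rwa [hconst x hxQ] at this
  rw [hE']
  refine hF'.trans ?_
  -- The success rate `p` is measured against all half-edges; the partner is uniform over the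
  -- smaller set `Q`, which only helps.
  have hQN : (Q.card : ℝ) ≤ Fintype.card H := by exact_mod_cast Finset.card_le_univ Q
  have h1 : p * Q.card ≤ T.card := (mul_le_mul_of_nonneg_left hQN hp0).trans hp
  have h2 : 0 ≤ (T.card - p * Q.card) * ((b' - b) * e) :=
    mul_nonneg (by linarith) (mul_nonneg (by linarith) he0)
  nlinarith [h2]

/-- Reveal the partners of half-edges in `R` one after the other, until a light target is hit. -/
theorem IsCylinder.card_le_of_trials (F : Matching H → Prop) [DecidablePred F]
    (light : H → Finset H → Prop)
    (T R₀ : Finset H) {p b : ℝ} {Z : ℕ} (hp0 : 0 ≤ p) (hp1 : p ≤ 1) (hb : 0 ≤ b)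
    (hT : ∀ A : Finset H, A.card ≤ Z → ∀ h ∈ R₀, ∃ T' ⊆ T,
      (∀ h' ∈ T', h' ∉ insert h A ∧ light h' (insert h (insert h' A))) ∧
        p * Fintype.card H ≤ T'.card)
    (hnext : ∀ h ∈ R₀, ∀ h' ∈ T, ∀ (A : Finset H) (E : Finset (Matching H)), IsCylinder A E →
      A.card ≤ Z → light h' A → (∀ σ ∈ E, σ.1 h = h') →
      ((E.filter F).card : ℝ) ≤ b * E.card) (t : ℕ) :
    ∀ (A R : Finset H) (E : Finset (Matching H)), IsCylinder A E → R ⊆ R₀ → Disjoint R A →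
      2 * t ≤ R.card → A.card + 2 * t ≤ Z →
      ((E.filter F).card : ℝ) ≤ ((1 - p) ^ t + b) * E.card := by
  induction t with
  | zero =>
    intro A R E _ _ _ _ _
    have h1 : ((E.filter F).card : ℝ) ≤ E.card := by
      exact_mod_cast Finset.card_filter_le E F
    have h2 : 0 ≤ b * (E.card : ℝ) := by positivity
    simp only [pow_zero]; linarith
  | succ t ih =>
    intro A R E hE hR hRA htR hAZ
    have hRne : R.Nonempty := by
      rw [← Finset.card_pos]; omega
    obtain ⟨h, hhR⟩ := hRne
    have hhA : h ∉ A := Finset.disjoint_left.1 hRA hhR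
    have hcard : ∀ h', (insert h (insert h' A)).card ≤ A.card + 2 := fun h' =>
      (Finset.card_insert_le _ _).trans (Nat.succ_le_succ (Finset.card_insert_le _ _))
    have hpt : 0 ≤ (1 - p) ^ t := pow_nonneg (by linarith) t
    obtain ⟨T', hT'T, hT'l, hT'c⟩ := hT A (by omega) h (hR hhR)
    have := hE.card_le_of_reveal hhA F (p := p) (b := b) (b' := (1 - p) ^ t + b)
      (T := T') (Finset.disjoint_left.2 fun x hx => (hT'l x hx).1) hT'c hp0 (by linarith)
      (by
        intro h' hh'
        exact hnext h (hR hhR) h' (hT'T hh') _ _ (hE.fiber h h') ((hcard h').trans (by omega))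
          (hT'l h' hh').2
          (fun σ hσ => (Finset.mem_filter.1 hσ).2))
      (by
        intro h' hh'A hh'
        -- After a failed trial the partner `h'` may itself lie in `R`, so each trial can use up two
        -- half-edges. This is why `R` must contain `2 * t` of them.
        refine ih (insert h (insert h' A)) ((R.erase h).erase h') _ (hE.fiber h h')
          (((Finset.erase_subset _ _).trans (Finset.erase_subset _ _)).trans hR) ?_ ?_ ?_
        · rw [Finset.disjoint_left]
          intro x hx
          simp only [Finset.mem_erase] at hx
          simp only [Finset.mem_insert, not_or]
          exact ⟨hx.2.1, hx.1, Finset.disjoint_left.1 hRA hx.2.2⟩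
        · have h1 := Finset.pred_card_le_card_erase (s := R) (a := h)
          have h2 := Finset.pred_card_le_card_erase (s := R.erase h) (a := h')
          omega
        · have := hcard h'
          omega)
    refine this.trans (le_of_eq ?_)
    ring

end Matching

/-! ### Half-edges, layers and how much of them has been revealed -/

variable {n : ℕ} {d : Fin n → ℕ}

theorem le_evenDegrees (d : Fin n → ℕ) (v : Fin n) : d v ≤ evenDegrees d v := Nat.le_add_right _ _

theorem card_halfEdge_le (d : Fin n → ℕ) : Fintype.card (HalfEdge d) ≤ ∑ v, d v + 1 := by
  have h0 : Fintype.card (HalfEdge d) = ∑ v, evenDegrees d v := by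
    rw [Fintype.card_sigma]
    exact Finset.sum_congr rfl fun v _ => Fintype.card_fin _
  simp only [evenDegrees, Finset.sum_add_distrib] at h0
  rw [h0]
  refine Nat.add_le_add_left ?_ _
  have h1 : ∀ v : Fin n, (if (v : ℕ) + 1 = n then (∑ w, d w) % 2 else 0)
      ≤ if (v : ℕ) + 1 = n then 1 else 0 := by
    intro v
    split_ifs
    · omega
    · exact le_rfl
  refine (Finset.sum_le_sum fun v _ => h1 v).trans ?_
  rw [Finset.sum_boole, Nat.cast_id, Finset.card_le_one]
  intro a ha b hb
  simp only [Finset.mem_filter, Finset.mem_univ, true_and] at ha hb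
  exact Fin.ext (by omega)

/-- The first `m` half-edges of the vertex `v`. -/
def firstHalfEdges (d : Fin n → ℕ) (m : ℕ) (v : Fin n) : Finset (HalfEdge d) :=
  Finset.univ.filter fun h => h.1 = v ∧ (h.2 : ℕ) < m

theorem mem_firstHalfEdges {m : ℕ} {v : Fin n} {h : HalfEdge d} :
    h ∈ firstHalfEdges d m v ↔ h.1 = v ∧ (h.2 : ℕ) < m := by
  simp [firstHalfEdges]

theorem card_firstHalfEdges {m : ℕ} {v : Fin n} (hm : m ≤ d v) :
    (firstHalfEdges d m v).card = m := by
  have hm' : m ≤ evenDegrees d v := hm.trans (le_evenDegrees d v)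
  have : firstHalfEdges d m v = (Finset.univ : Finset (Fin m)).map
      ⟨fun j => (⟨v, Fin.castLE hm' j⟩ : HalfEdge d), fun a b e => by
        have := eq_of_heq (Sigma.mk.inj e).2
        exact Fin.castLE_injective hm' this⟩ := by
    ext ⟨w, j⟩
    simp only [mem_firstHalfEdges, Finset.mem_map, Finset.mem_univ, true_and]
    constructor
    · rintro ⟨rfl, hj⟩
      exact ⟨⟨j, hj⟩, rfl⟩
    · rintro ⟨i, hi⟩
      cases hi
      exact ⟨rfl, i.2⟩
  rw [this, Finset.card_map, Finset.card_univ, Fintype.card_fin]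

/-- The first `m` half-edges of all vertices of degree at least `m`. -/
def layerHalfEdges (d : Fin n → ℕ) (m : ℕ) : Finset (HalfEdge d) :=
  Finset.univ.filter fun h => m ≤ d h.1 ∧ (h.2 : ℕ) < m

theorem mem_layerHalfEdges {m : ℕ} {h : HalfEdge d} :
    h ∈ layerHalfEdges d m ↔ m ≤ d h.1 ∧ (h.2 : ℕ) < m := by
  simp [layerHalfEdges]

theorem card_layerHalfEdges (d : Fin n → ℕ) (m : ℕ) :
    (layerHalfEdges d m).card = (Finset.univ.filter fun v => m ≤ d v).card * m := by
  rw [Finset.card_eq_sum_card_fiberwise (f := fun h : HalfEdge d => h.1)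
    (t := Finset.univ.filter fun v => m ≤ d v)
    (fun h hh => by simpa using (mem_layerHalfEdges.1 hh).1)]
  rw [Finset.sum_const_nat]
  intro v hv
  have hv' : m ≤ d v := by simpa using hv
  refine Eq.trans (congrArg Finset.card ?_) (card_firstHalfEdges hv')
  ext h
  simp only [Finset.mem_filter, mem_layerHalfEdges, mem_firstHalfEdges]
  constructor
  · rintro ⟨⟨_, h2⟩, h3⟩; exact ⟨h3, h2⟩
  · rintro ⟨rfl, h2⟩; exact ⟨⟨hv', h2⟩, rfl⟩

/-- At most half of the first `m` half-edges of the vertex of `h` lie in `A`. -/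
def IsLight (m : ℕ) (h : HalfEdge d) (A : Finset (HalfEdge d)) : Prop :=
  2 * (firstHalfEdges d m h.1 ∩ A).card ≤ m

-- A vertex with more than a quarter of its first `m` half-edges in `A` accounts for more than `m /
-- 4` elements of `A`, but contributes at most `m` half-edges to the layer.
open Classical in
theorem card_heavy_le (m : ℕ) (A : Finset (HalfEdge d)) :
    ((layerHalfEdges d m).filter fun h => m < 4 * (firstHalfEdges d m h.1 ∩ A).card).card
      ≤ 4 * A.card := by
  have hA : A.card = ∑ v : Fin n, (A.filter fun h => h.1 = v).card :=
    Finset.card_eq_sum_card_fiberwise (f := fun h : HalfEdge d => h.1) (t := Finset.univ)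
      (fun _ _ => Finset.mem_coe.2 (Finset.mem_univ _))
  rw [hA, Finset.mul_sum, Finset.card_eq_sum_card_fiberwise (f := fun h : HalfEdge d => h.1)
    (t := Finset.univ) (fun _ _ => Finset.mem_coe.2 (Finset.mem_univ _))]
  refine Finset.sum_le_sum fun v _ => ?_
  rcases Finset.eq_empty_or_nonempty (((layerHalfEdges d m).filter fun h =>
    m < 4 * (firstHalfEdges d m h.1 ∩ A).card).filter fun h => h.1 = v) with he | ⟨h₀, hh₀⟩
  · rw [he]; simp
  simp only [Finset.mem_filter, mem_layerHalfEdges] at hh₀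
  obtain ⟨⟨⟨hd, _⟩, hheavy⟩, rfl⟩ := hh₀
  have h1 : (((layerHalfEdges d m).filter fun h =>
      m < 4 * (firstHalfEdges d m h.1 ∩ A).card).filter fun h => h.1 = h₀.1).card ≤ m := by
    refine le_trans (Finset.card_le_card fun h hh => ?_) (card_firstHalfEdges hd).le
    simp only [Finset.mem_filter, mem_layerHalfEdges] at hh
    exact mem_firstHalfEdges.2 ⟨hh.2, hh.1.1.2⟩
  have h2 : (firstHalfEdges d m h₀.1 ∩ A).card ≤ (A.filter fun h => h.1 = h₀.1).card := by
    refine Finset.card_le_card fun h hh => ?_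
    rw [Finset.mem_inter, mem_firstHalfEdges] at hh
    exact Finset.mem_filter.2 ⟨hh.2, hh.1.1⟩
  omega

-- The lost targets are `insert h A` and the at most `4 * A.card` half-edges at vertices more than a
-- quarter used. Elsewhere the reveal adds at most two used half-edges, and `m / 4 + 2 ≤ m / 2`
-- because `8 ≤ m`: the new vertex is still light and can serve for the next climb.
open Classical in
theorem card_layerHalfEdges_le {m : ℕ} (hm : 8 ≤ m) (A : Finset (HalfEdge d)) (h : HalfEdge d) :
    (layerHalfEdges d m).card ≤ ((layerHalfEdges d m).filter fun h' =>
      h' ∉ insert h A ∧ IsLight m h' (insert h (insert h' A))).card + (5 * A.card + 1) := by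
  have hsub : layerHalfEdges d m ⊆ ((layerHalfEdges d m).filter fun h' =>
      h' ∉ insert h A ∧ IsLight m h' (insert h (insert h' A))) ∪ (insert h A ∪
      (layerHalfEdges d m).filter fun h' => m < 4 * (firstHalfEdges d m h'.1 ∩ A).card) := by
    intro h' hh'
    simp only [Finset.mem_union, Finset.mem_filter]
    by_cases h1 : h' ∈ insert h A
    · exact Or.inr (Or.inl h1)
    by_cases h2 : m < 4 * (firstHalfEdges d m h'.1 ∩ A).card
    · exact Or.inr (Or.inr ⟨hh', h2⟩)
    refine Or.inl ⟨hh', h1, ?_⟩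
    have h3 : (firstHalfEdges d m h'.1 ∩ insert h (insert h' A)).card
        ≤ (firstHalfEdges d m h'.1 ∩ A).card + 2 := by
      have : firstHalfEdges d m h'.1 ∩ insert h (insert h' A)
          ⊆ insert h (insert h' (firstHalfEdges d m h'.1 ∩ A)) := by
        intro x hx
        simp only [Finset.mem_inter, Finset.mem_insert] at hx ⊢
        tauto
      exact (Finset.card_le_card this).trans ((Finset.card_insert_le _ _).trans
        (Nat.succ_le_succ (Finset.card_insert_le _ _)))
    unfold IsLight
    omega
  have h1 := Finset.card_le_card hsub
  have h2 := Finset.card_union_le ((layerHalfEdges d m).filter fun h' =>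
      h' ∉ insert h A ∧ IsLight m h' (insert h (insert h' A))) (insert h A ∪
      (layerHalfEdges d m).filter fun h' => m < 4 * (firstHalfEdges d m h'.1 ∩ A).card)
  have h3 := Finset.card_union_le (insert h A)
    ((layerHalfEdges d m).filter fun h' => m < 4 * (firstHalfEdges d m h'.1 ∩ A).card)
  have h4 := card_heavy_le m A
  have h5 := Finset.card_insert_le h A
  omega

/-! ### Climbing to hubs and joining them -/

/-- Some vertex of degree at least `M` is within distance `r` of `v`. -/
def NearHub (σ : Matching (HalfEdge d)) (M r : ℕ) (v : Fin n) : Prop :=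
  ∃ w, M ≤ d w ∧ (graph (d := d) σ).edist v w ≤ r

theorem edist_le_one_of_apply_eq (σ : Matching (HalfEdge d)) {h h' : HalfEdge d}
    (e : σ.1 h = h') : (graph (d := d) σ).edist h.1 h'.1 ≤ 1 := by
  by_cases hv : h.1 = h'.1
  · rw [hv, SimpleGraph.edist_self]; simp
  · have : (graph (d := d) σ).Adj h.1 h'.1 := ⟨hv, h, rfl, by rw [e]⟩
    exact le_of_eq (SimpleGraph.edist_eq_one_iff_adj.2 this)

theorem NearHub.succ {σ : Matching (HalfEdge d)} {M r : ℕ} {h h' : HalfEdge d}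
    (e : σ.1 h = h') (hr : NearHub σ M r h'.1) : NearHub σ M (r + 1) h.1 := by
  obtain ⟨w, hw, hd⟩ := hr
  refine ⟨w, hw, (SimpleGraph.edist_triangle (v := h'.1)).trans ?_⟩
  push_cast
  rw [add_comm (r : ℕ∞)]
  exact add_le_add (edist_le_one_of_apply_eq σ e) hd

open Classical in
/-- Greedy climbing through the layers of vertices of degree at least `m i`. -/
theorem card_not_nearHub_le {m : ℕ → ℕ} {p : ℕ → ℝ} {K Z : ℕ}
    (hm : ∀ i, 1 ≤ i → i ≤ K → 8 ≤ m i) (hp0 : ∀ i, 1 ≤ i → i ≤ K → 0 ≤ p i)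
    (hp1 : ∀ i, 1 ≤ i → i ≤ K → p i ≤ 1)
    (hp : ∀ i, 1 ≤ i → i ≤ K →
      p i * Fintype.card (HalfEdge d) + (5 * Z + 1) ≤ (layerHalfEdges d (m i)).card) (r : ℕ) :
    ∀ i, i + r = K → ∀ v, m i ≤ d v → ∀ (A : Finset (HalfEdge d))
      (E : Finset (Matching (HalfEdge d))), IsCylinder A E →
      2 * (firstHalfEdges d (m i) v ∩ A).card ≤ m i →
      A.card + ∑ j ∈ Finset.Ico i K, 2 * (m j / 4) ≤ Z →
      ((E.filter fun σ => ¬ NearHub σ (m K) r v).card : ℝ)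
        ≤ (∑ j ∈ Finset.Ico i K, (1 - p (j + 1)) ^ (m j / 4)) * E.card := by
  induction r with
  | zero =>
    intro i hi v hv A E _ _ _
    obtain rfl : i = K := hi
    rw [Finset.filter_false_of_mem]
    · simp
    · intro σ _ h
      exact h ⟨v, hv, by simp⟩
  | succ r ih =>
    intro i hi v hv A E hE hlight hZ
    have hiK : i < K := by omega
    rw [Finset.sum_eq_sum_Ico_succ_bot hiK] at hZ ⊢
    have hb : 0 ≤ ∑ j ∈ Finset.Ico (i + 1) K, (1 - p (j + 1)) ^ (m j / 4) :=
      Finset.sum_nonneg fun j hj => pow_nonneg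
        (by linarith [hp1 (j + 1) (by omega) (Finset.mem_Ico.1 hj).2]) _
    -- A light vertex has at least `m i / 2` free half-edges, enough for `m i / 4` trials. The local
    -- budget pays for this layer only, leaving the rest of `Z` to the induction hypothesis.
    refine hE.card_le_of_trials (fun σ => ¬ NearHub σ (m K) (r + 1) v) (IsLight (m (i + 1)))
      (layerHalfEdges d (m (i + 1))) (firstHalfEdges d (m i) v) (Z := A.card + 2 * (m i / 4))
      (hp0 (i + 1) (by omega) hiK) (hp1 (i + 1) (by omega) hiK) hb ?_ ?_ (m i / 4) A (firstHalfEdges d (m i) v \ A) E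
      Finset.sdiff_subset Finset.sdiff_disjoint ?_ le_rfl
    · intro A' hA' h _
      have h1 := card_layerHalfEdges_le (hm (i + 1) (by omega) hiK) A' h
      have h2 := hp (i + 1) (by omega) hiK
      have h3 : A'.card ≤ Z := by omega
      refine ⟨_, Finset.filter_subset (fun h' => h' ∉ insert h A' ∧
        IsLight (m (i + 1)) h' (insert h (insert h' A'))) _,
        fun h' hh' => (Finset.mem_filter.1 hh').2, ?_⟩
      have h1' : ((layerHalfEdges d (m (i + 1))).card : ℝ) ≤
        ((layerHalfEdges d (m (i + 1))).filter fun h' => h' ∉ insert h A' ∧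
          IsLight (m (i + 1)) h' (insert h (insert h' A'))).card + (5 * A'.card + 1) := by
        exact_mod_cast h1
      have h3' : (A'.card : ℝ) ≤ Z := by exact_mod_cast h3
      linarith
    · intro h hh h' hh' A' E' hE' hA' hl hσ
      have hv' := (mem_layerHalfEdges.1 hh').1
      have := ih (i + 1) (by omega) h'.1 hv' A' E' hE' hl (by omega)
      refine le_trans ?_ this
      have hsub : (E'.filter fun σ => ¬ NearHub σ (m K) (r + 1) v) ⊆
          E'.filter fun σ => ¬ NearHub σ (m K) r h'.1 := by
        intro σ hs
        rw [Finset.mem_filter] at hs ⊢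
        refine ⟨hs.1, fun hn => hs.2 ?_⟩
        rw [← (mem_firstHalfEdges.1 hh).1]
        exact NearHub.succ (hσ σ hs.1) hn
      exact_mod_cast Finset.card_le_card hsub
    · have h1 := card_firstHalfEdges hv
      have h2 := Finset.card_sdiff_add_card_inter (firstHalfEdges d (m i) v) A
      omega

theorem isCylinder_univ {H : Type*} [Finite H] :
    IsCylinder (∅ : Finset H) (Finset.univ : Finset (Matching H)) :=
  ⟨by simp, by simp⟩

-- Try `m / 8` half-edges of `a`, with the first `m` half-edges of `b` as targets. At most `m / 4 +
-- 1` half-edges are excluded, so at least half of the targets always remain; once one is hit,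
-- adjacency is certain, hence `b := 0`.
open Classical in
theorem card_not_adj_le {m : ℕ} (hm : 4 ≤ m) {a b : Fin n} (hab : a ≠ b) (ha : m ≤ d a)
    (hb : m ≤ d b) :
    ((Finset.univ.filter fun σ : Matching (HalfEdge d) => ¬ (graph (d := d) σ).Adj a b).card : ℝ)
      ≤ (1 - m / (2 * Fintype.card (HalfEdge d))) ^ (m / 8)
        * (Finset.univ : Finset (Matching (HalfEdge d))).card := by
  have hmH : m ≤ Fintype.card (HalfEdge d) := by
    rw [← card_firstHalfEdges ha]; exact Finset.card_le_univ _
  have hmH' : (m : ℝ) ≤ Fintype.card (HalfEdge d) := by exact_mod_cast hmH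
  have hm' : (4 : ℝ) ≤ m := by exact_mod_cast hm
  have hH : (0 : ℝ) < 2 * Fintype.card (HalfEdge d) := by linarith
  have := IsCylinder.card_le_of_trials (H := HalfEdge d)
    (fun σ : Matching (HalfEdge d) => ¬ (graph (d := d) σ).Adj a b) (fun _ _ => True)
    (firstHalfEdges d m b)
    (firstHalfEdges d m a) (p := m / (2 * Fintype.card (HalfEdge d))) (b := 0)
    (Z := 2 * (m / 8)) (by positivity) (by rw [div_le_one hH]; linarith) le_rfl ?_ ?_ (m / 8) ∅
    (firstHalfEdges d m a) Finset.univ (isCylinder_univ (H := HalfEdge d)) subset_rfl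
    (Finset.disjoint_empty_right _)
    (by rw [card_firstHalfEdges ha]; omega) (by simp)
  · rwa [add_zero] at this
  · intro A hA h _
    have h1 := Finset.le_card_sdiff (insert h A) (firstHalfEdges d m b)
    rw [card_firstHalfEdges hb] at h1
    have h2 := Finset.card_insert_le h A
    refine ⟨firstHalfEdges d m b \ insert h A, Finset.sdiff_subset,
      fun h' hh' => ⟨(Finset.mem_sdiff.1 hh').2, trivial⟩, ?_⟩
    have h3 : m ≤ 2 * (firstHalfEdges d m b \ insert h A).card := by omega
    have h3' : (m : ℝ) ≤ 2 * (firstHalfEdges d m b \ insert h A).card := by exact_mod_cast h3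
    have : (m : ℝ) / (2 * Fintype.card (HalfEdge d)) * Fintype.card (HalfEdge d) = m / 2 := by
      have : (Fintype.card (HalfEdge d) : ℝ) ≠ 0 := by linarith
      field_simp
    rw [this]; linarith
  · intro h hh h' hh' A E _ _ _ hσ
    rw [Finset.filter_false_of_mem]
    · simp
    · intro σ hs hn
      refine hn ⟨hab, h, (mem_firstHalfEdges.1 hh).1, ?_⟩
      rw [hσ σ hs, (mem_firstHalfEdges.1 hh').1]

open Classical in
/-- Two vertices of high degree are joined through the hubs they climb to. -/
theorem card_far_le {M K : ℕ} (hM : 4 ≤ M) {u v : Fin n} {B : ℝ}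
    (hu : ((Finset.univ.filter fun σ : Matching (HalfEdge d) => ¬ NearHub σ M K u).card : ℝ)
      ≤ B * (Finset.univ : Finset (Matching (HalfEdge d))).card)
    (hv : ((Finset.univ.filter fun σ : Matching (HalfEdge d) => ¬ NearHub σ M K v).card : ℝ)
      ≤ B * (Finset.univ : Finset (Matching (HalfEdge d))).card)
    (h1 : (M : ℝ) ≤ 2 * Fintype.card (HalfEdge d)) :
    ((Finset.univ.filter fun σ : Matching (HalfEdge d) =>
        ¬ (graph (d := d) σ).edist u v ≤ (2 * K + 1 : ℕ)).card : ℝ)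
      ≤ (2 * B + n ^ 2 * (1 - M / (2 * Fintype.card (HalfEdge d))) ^ (M / 8))
        * (Finset.univ : Finset (Matching (HalfEdge d))).card := by
  set P := (Finset.univ : Finset (Matching (HalfEdge d)))
  set q : ℝ := (1 - M / (2 * Fintype.card (HalfEdge d))) ^ (M / 8) with hq
  have hq0 : 0 ≤ q := pow_nonneg (sub_nonneg.2 (div_le_one_of_le₀ h1 (by positivity))) _
  -- The hubs reached depend on the matching, so a union bound over all pairs of hubs is needed.
  set bad : Fin n × Fin n → Finset (Matching (HalfEdge d)) := fun x =>
    if x.1 ≠ x.2 ∧ M ≤ d x.1 ∧ M ≤ d x.2 then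
      P.filter fun σ : Matching (HalfEdge d) => ¬ (graph (d := d) σ).Adj x.1 x.2 else ∅ with hbad
  have hbadc : ∀ x, ((bad x).card : ℝ) ≤ q * P.card := by
    intro x
    by_cases hx : x.1 ≠ x.2 ∧ M ≤ d x.1 ∧ M ≤ d x.2
    · simp only [hbad, if_pos hx]
      exact card_not_adj_le hM hx.1 hx.2.1 hx.2.2
    · simp only [hbad, if_neg hx, Finset.card_empty, Nat.cast_zero]
      positivity
  have hsub : (P.filter fun σ : Matching (HalfEdge d) =>
        ¬ (graph (d := d) σ).edist u v ≤ (2 * K + 1 : ℕ)) ⊆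
      ((P.filter fun σ : Matching (HalfEdge d) => ¬ NearHub σ M K u) ∪
        P.filter fun σ : Matching (HalfEdge d) => ¬ NearHub σ M K v) ∪
        Finset.univ.biUnion bad := by
    intro σ hσ
    by_contra hn
    rw [Finset.mem_union, Finset.mem_union, not_or, not_or] at hn
    obtain ⟨⟨hnu, hnv⟩, hnb⟩ := hn
    have hnu' : NearHub σ M K u := by
      by_contra h; exact hnu (Finset.mem_filter.2 ⟨Finset.mem_univ _, h⟩)
    have hnv' : NearHub σ M K v := by
      by_contra h; exact hnv (Finset.mem_filter.2 ⟨Finset.mem_univ _, h⟩)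
    obtain ⟨a, ha, hua⟩ := hnu'
    obtain ⟨b, hb, hvb⟩ := hnv'
    have hab : (graph (d := d) σ).edist a b ≤ 1 := by
      by_cases e : a = b
      · rw [e, SimpleGraph.edist_self]; simp
      · refine le_of_eq (SimpleGraph.edist_eq_one_iff_adj.2 ?_)
        by_contra h
        refine hnb (Finset.mem_biUnion.2 ⟨(a, b), Finset.mem_univ _, ?_⟩)
        simp only [hbad]
        rw [if_pos ⟨e, ha, hb⟩]
        exact Finset.mem_filter.2 ⟨Finset.mem_univ _, h⟩
    refine (Finset.mem_filter.1 hσ).2 ?_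
    calc (graph (d := d) σ).edist u v
        ≤ (graph (d := d) σ).edist u a + (graph (d := d) σ).edist a v :=
          SimpleGraph.edist_triangle
      _ ≤ (graph (d := d) σ).edist u a +
          ((graph (d := d) σ).edist a b + (graph (d := d) σ).edist b v) := by
          gcongr; exact SimpleGraph.edist_triangle
      _ ≤ (K : ℕ∞) + (1 + K) := by
          rw [SimpleGraph.edist_comm (u := b)]
          gcongr
      _ = (2 * K + 1 : ℕ) := by push_cast; ring
  have hc := (Finset.card_le_card hsub).trans ((Finset.card_union_le _ _).trans
    (Nat.add_le_add (Finset.card_union_le _ _) Finset.card_biUnion_le))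
  have hc' : ((P.filter fun σ : Matching (HalfEdge d) =>
        ¬ (graph (d := d) σ).edist u v ≤ (2 * K + 1 : ℕ)).card : ℝ) ≤
      ((P.filter fun σ : Matching (HalfEdge d) => ¬ NearHub σ M K u).card +
        (P.filter fun σ : Matching (HalfEdge d) => ¬ NearHub σ M K v).card)
        + ∑ x, ((bad x).card : ℝ) := by exact_mod_cast hc
  have hs : ∑ x, ((bad x).card : ℝ) ≤ n ^ 2 * (q * P.card) := by
    refine (Finset.sum_le_card_nsmul _ _ _ fun x _ => hbadc x).trans (le_of_eq ?_)
    rw [nsmul_eq_mul, Finset.card_univ, Fintype.card_prod, Fintype.card_fin]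
    push_cast; ring
  linarith

/-! ### Analytic estimates and the layer exponents -/

open Filter in
theorem eventually_mul_rpow_le {γ : ℝ} (hγ : γ < 1) (D : ℝ) {ν : ℝ} (hν : 0 < ν) :
    ∀ᶠ x : ℝ in atTop, D * x ^ γ ≤ ν * x := by
  have h := (tendsto_rpow_neg_atTop (sub_pos.2 hγ)).const_mul D
  rw [mul_zero] at h
  filter_upwards [h.eventually_le_const hν, eventually_gt_atTop 0] with x hx hx0
  calc D * x ^ γ = D * x ^ (-(1 - γ)) * x := by
        rw [neg_sub, Real.rpow_sub hx0, Real.rpow_one]; field_simp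
    _ ≤ ν * x := by gcongr

open Filter Asymptotics in
theorem eventually_mul_le_exp (D : ℝ) {ν : ℝ} (hν : 0 < ν) :
    ∀ᶠ x : ℝ in atTop, D * x ≤ Real.exp (ν * x) := by
  have h : (fun x : ℝ => D * x) =o[atTop] fun x : ℝ => Real.exp (ν * x) := by
    have := (isLittleO_pow_exp_pos_mul_atTop 1 hν).const_mul_left D
    simpa using this
  filter_upwards [h.bound one_pos] with x hx
  rw [Real.norm_eq_abs, Real.norm_eq_abs, abs_of_nonneg (Real.exp_pos _).le, one_mul] at hx
  exact (le_abs_self _).trans hx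

open Filter in
/-- The logarithms of the degree thresholds of the layers. -/
theorem exists_layer_exponents {s γ D κ η L : ℝ} (hs : 1 < s) (hγ : γ ∈ Set.Ioo (0 : ℝ) 1)
    (hD : 0 ≤ D) (hκ : 0 < κ) (hη : 0 < η) :
    ∃ (A : ℝ) (a : ℕ → ℝ), L ≤ A ∧ 0 < A ∧ a 0 = 2 * A ∧ (∀ i, A * s ^ i ≤ a i) ∧
      (∀ i, D * a (i + 1) ^ γ ≤ a i - a (i + 1) / s) ∧
      ∀ K, ∑ i ∈ Finset.range K, Real.exp (-(κ * Real.exp ((A * s ^ i) ^ γ))) ≤ η := by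
  have hs0 : 0 < s := by linarith
  set θ : ℝ := s ^ (γ - 1) with hθ
  have hθ0 : 0 < θ := Real.rpow_pos_of_pos hs0 _
  have hθ1 : θ < 1 := Real.rpow_lt_one_of_one_lt_of_neg hs (by linarith [hγ.2])
  have hsθ : s * θ = s ^ γ := by
    rw [hθ, Real.rpow_sub hs0, Real.rpow_one]; field_simp
  have hsγ : 1 < s ^ γ := Real.one_lt_rpow hs hγ.1
  set ρ : ℝ := (s ^ γ)⁻¹ with hρ
  have hρ0 : 0 < ρ := by positivity
  have hρ1 : ρ < 1 := inv_lt_one_of_one_lt₀ hsγ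
  obtain ⟨A, hAL, hA0, hA1, hA2⟩ := ((eventually_ge_atTop L).and ((eventually_gt_atTop 0).and
    ((eventually_mul_rpow_le hγ.2 (D * (2 * s) ^ γ) (sub_pos.2 hθ1)).and
      ((tendsto_rpow_atTop hγ.1).eventually_ge_atTop (1 / (κ * η * (1 - ρ))))))).exists
  have hpow : ∀ i : ℕ, (A * s ^ i) ^ γ = A ^ γ * (s ^ γ) ^ i := by
    intro i
    rw [Real.mul_rpow hA0.le (by positivity), ← Real.rpow_natCast, ← Real.rpow_natCast,
      ← Real.rpow_mul hs0.le, ← Real.rpow_mul hs0.le, mul_comm γ]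
  -- The factor `1 + θ ^ i` decreases from 2 to 1. Since `s * θ = s ^ γ`, the slack `a i - a (i + 1)
  -- / s` equals `A (1 - θ) (s ^ γ) ^ i`, the same growth in `i` as the bound on `a (i + 1) ^ γ`; a
  -- large `A` beats the constants because `γ < 1`.
  refine ⟨A, fun i => A * s ^ i * (1 + θ ^ i), hAL, hA0, by simp; ring, fun i => ?_, fun i => ?_,
    fun K => ?_⟩
  · have : 0 ≤ A * s ^ i * θ ^ i := by positivity
    linarith
  · have h1 : A * s ^ i * (1 + θ ^ i) - A * s ^ (i + 1) * (1 + θ ^ (i + 1)) / s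
        = (s ^ γ) ^ i * ((1 - θ) * A) := by
      rw [← hsθ, mul_pow]; field_simp; ring
    have h2 : (A * s ^ (i + 1) * (1 + θ ^ (i + 1))) ^ γ ≤ (s ^ γ) ^ i * ((2 * s) ^ γ * A ^ γ) := by
      have h3 : A * s ^ (i + 1) * (1 + θ ^ (i + 1)) ≤ (2 * s) * (A * s ^ i) := by
        have : θ ^ (i + 1) ≤ 1 := pow_le_one₀ hθ0.le hθ1.le
        have h4 : 0 ≤ A * s ^ (i + 1) := by positivity
        calc A * s ^ (i + 1) * (1 + θ ^ (i + 1)) ≤ A * s ^ (i + 1) * 2 := by gcongr; linarith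
          _ = _ := by ring
      refine (Real.rpow_le_rpow (by positivity) h3 hγ.1.le).trans (le_of_eq ?_)
      rw [Real.mul_rpow (by positivity) (by positivity), hpow]; ring
    simp only
    rw [h1]
    calc D * (A * s ^ (i + 1) * (1 + θ ^ (i + 1))) ^ γ
        ≤ D * ((s ^ γ) ^ i * ((2 * s) ^ γ * A ^ γ)) := by gcongr
      _ = (s ^ γ) ^ i * (D * (2 * s) ^ γ * A ^ γ) := by ring
      _ ≤ _ := by gcongr
  · have hAγ : 0 < A ^ γ := Real.rpow_pos_of_pos hA0 _
    -- Using `y ≤ exp y` twice turns the double exponential into a geometric sequence of ratio `ρ`.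
    have h1 : ∀ i : ℕ, Real.exp (-(κ * Real.exp ((A * s ^ i) ^ γ))) ≤ (κ * A ^ γ)⁻¹ * ρ ^ i := by
      intro i
      rw [hpow, hρ, inv_pow, ← mul_inv, Real.exp_neg]
      refine inv_anti₀ (by positivity) ?_
      calc κ * A ^ γ * (s ^ γ) ^ i = κ * (A ^ γ * (s ^ γ) ^ i) := by ring
        _ ≤ κ * Real.exp (A ^ γ * (s ^ γ) ^ i) := by
          gcongr; linarith [Real.add_one_le_exp (A ^ γ * (s ^ γ) ^ i)]
        _ ≤ _ := by linarith [Real.add_one_le_exp (κ * Real.exp (A ^ γ * (s ^ γ) ^ i))]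
    calc _ ≤ ∑ i ∈ Finset.range K, (κ * A ^ γ)⁻¹ * ρ ^ i := Finset.sum_le_sum fun i _ => h1 i
      _ = (κ * A ^ γ)⁻¹ * ∑ i ∈ Finset.range K, ρ ^ i := by rw [Finset.mul_sum]
      _ ≤ (κ * A ^ γ)⁻¹ * (1 - ρ)⁻¹ := by
        gcongr
        rw [← tsum_geometric_of_lt_one hρ0.le hρ1]
        exact (summable_geometric_of_lt_one hρ0.le hρ1).sum_le_tsum _ fun i _ => by positivity
      _ ≤ η := by
        have h1ρ : 0 < 1 - ρ := by linarith
        rw [div_le_iff₀ (by positivity)] at hA2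
        rw [← mul_inv, inv_le_iff_one_le_mul₀ (by positivity)]
        calc (1 : ℝ) ≤ A ^ γ * (κ * η * (1 - ρ)) := hA2
          _ = _ := by ring

/-- Apply the tail bound at `x = exp b`; each vertex counted contributes at least `exp b`
half-edges, which lowers the exponent from `τ - 1` to `τ - 2`. -/
theorem Admissible.card_layerHalfEdges_ge {τ γ C c β x₀ α : ℝ}
    (hd : Admissible τ γ C c β x₀ α d) (hn : 1 ≤ n) {b : ℝ} (hb : 0 < b) (hx : x₀ ≤ Real.exp b)
    (hbα : b < α * Real.log n) :
    c * n * Real.exp (-((τ - 2) * b) + C * b ^ γ) ≤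
      (layerHalfEdges d ⌈Real.exp b⌉₊).card := by
  have hn0 : (0 : ℝ) < n := by exact_mod_cast hn
  have htail := hd.tail_ge (Real.exp b) (Real.one_lt_exp_iff.2 hb) hx (by
    rw [Real.rpow_def_of_pos hn0, Real.exp_lt_exp]; linarith)
  rw [Real.log_exp, ← Real.exp_mul, div_eq_mul_inv, ← Real.exp_neg] at htail
  have hcompl : 1 - empiricalCDF d (Real.exp b) ≤
      ((Finset.univ.filter fun v => ⌈Real.exp b⌉₊ ≤ d v).card : ℝ) / n := by
    unfold empiricalCDF
    rw [Nat.card_eq_fintype_card, Fintype.card_subtype, one_sub_div hn0.ne']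
    gcongr
    have h1 := Finset.card_filter_add_card_filter_not (s := (Finset.univ : Finset (Fin n)))
      (fun v => (d v : ℝ) ≤ Real.exp b)
    rw [Finset.card_univ, Fintype.card_fin] at h1
    have h2 : (Finset.univ.filter fun v => ¬ (d v : ℝ) ≤ Real.exp b).card ≤
        (Finset.univ.filter fun v => ⌈Real.exp b⌉₊ ≤ d v).card := by
      refine Finset.card_le_card fun v hv => ?_
      rw [Finset.mem_filter] at hv ⊢
      exact ⟨hv.1, Nat.ceil_le.2 (not_le.1 hv.2).le⟩
    have h3 : (n : ℝ) ≤ (Finset.univ.filter fun v => (d v : ℝ) ≤ Real.exp b).card +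
        (Finset.univ.filter fun v => ⌈Real.exp b⌉₊ ≤ d v).card := by
      exact_mod_cast (by omega)
    linarith
  have h1 := htail.le.trans hcompl
  rw [le_div_iff₀ hn0] at h1
  rw [card_layerHalfEdges]
  push_cast
  calc c * n * Real.exp (-((τ - 2) * b) + C * b ^ γ)
      = (c * Real.exp (-(b * (τ - 1 - C * b ^ (γ - 1)))) * n) * Real.exp b := by
        have : b * b ^ (γ - 1) = b ^ γ := by
          rw [Real.rpow_sub hb, Real.rpow_one]; field_simp
        have h2 : -((τ - 2) * b) + C * b ^ γ = -(b * (τ - 1 - C * b ^ (γ - 1))) + b := by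
          rw [← this]; ring
        rw [h2, Real.exp_add]; ring
    _ ≤ _ := mul_le_mul h1 (Nat.le_ceil _) (Real.exp_pos _).le (by positivity)

theorem Admissible.card_halfEdge_le {τ γ C c β x₀ α : ℝ}
    (hd : Admissible τ γ C c β x₀ α d) (hn : 1 ≤ n) :
    (Fintype.card (HalfEdge d) : ℝ) ≤ (β + 1) * n := by
  have h1 : (Fintype.card (HalfEdge d) : ℝ) ≤ (∑ v, d v : ℕ) + 1 := by
    exact_mod_cast ConfigurationModel.card_halfEdge_le d
  have h2 := hd.total_le
  have hn0 : (1 : ℝ) ≤ n := by exact_mod_cast hn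
  linarith

theorem one_sub_pow_le_exp {p x : ℝ} {t : ℕ} (hp1 : p ≤ 1) (hx : x ≤ p * t) :
    (1 - p) ^ t ≤ Real.exp (-x) :=
  calc (1 - p) ^ t ≤ Real.exp (-p) ^ t :=
        pow_le_pow_left₀ (by linarith) (Real.one_sub_le_exp_neg p) t
    _ = Real.exp (-(p * t)) := by rw [← Real.exp_nat_mul]; ring_nf
    _ ≤ _ := by gcongr

-- Read `x` as `log n`. The third clause says that half the hub layer outweighs everything explored,
-- which needs `1 - μ (τ - 2) > μ`. The fourth is the union bound over hub pairs, which needs `2 μ >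
-- 1`.
open Filter in
theorem eventually_large {τ γ C c β μ s η : ℝ} (hγ : γ ∈ Set.Ioo (0 : ℝ) 1) (hc : 0 < c)
    (hβ : 0 < β) (hs : 1 < s) (hη : 0 < η) (hμ : 1 / 2 < μ) (hμτ : μ * (τ - 1) < 1) (A : ℝ) :
    ∀ᶠ x : ℝ in atTop, 1 ≤ x ∧ 2 * A < μ * x ∧
      6 * (Real.log x / Real.log s) * Real.exp (μ * x) ≤
        c / 2 * Real.exp x * Real.exp (-((τ - 2) * (μ * x)) - |C| * (μ * x) ^ γ) ∧
      Real.exp x ^ 2 * Real.exp (-(Real.exp (μ * x) ^ 2 / (32 * ((β + 1) * Real.exp x)))) ≤ η := by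
  have hμ0 : 0 < μ := by linarith
  have hlog : 0 < Real.log s := Real.log_pos hs
  -- Half of the margin `ν` absorbs the `γ`-power correction, the other half the logarithmic number
  -- of layers.
  set ν := 1 - μ * (τ - 1) with hν
  have hν0 : 0 < ν / 2 := by rw [hν]; linarith
  have e1 := eventually_mul_rpow_le hγ.2 (|C| * μ ^ γ) hν0
  have e2 := eventually_mul_le_exp (12 / (c * Real.log s)) hν0
  have e3 := eventually_mul_le_exp (32 * (β + 1) * 3) (ν := 2 * μ - 1) (by linarith)
  filter_upwards [e1, e2, e3, eventually_ge_atTop 1, eventually_gt_atTop (2 * A / μ),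
    eventually_ge_atTop (-Real.log η)] with x h1 h2 h3 hx1 hxA hxη
  refine ⟨hx1, ?_, ?_, ?_⟩
  · rw [div_lt_iff₀ hμ0] at hxA; linarith
  · have hx0 : 0 < x := by linarith
    have h4 : Real.log x ≤ x := Real.log_le_self hx0.le
    have h5 : 12 / (c * Real.log s) * Real.log x ≤ Real.exp (ν / 2 * x) :=
      (mul_le_mul_of_nonneg_left h4 (by positivity)).trans h2
    rw [Real.mul_rpow hμ0.le hx0.le]
    calc 6 * (Real.log x / Real.log s) * Real.exp (μ * x)
        = c / 2 * (12 / (c * Real.log s) * Real.log x) * Real.exp (μ * x) := by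
          field_simp; ring
      _ ≤ c / 2 * Real.exp (ν / 2 * x) * Real.exp (μ * x) := by gcongr
      _ = c / 2 * Real.exp (ν / 2 * x + μ * x) := by rw [Real.exp_add]; ring
      _ ≤ c / 2 * Real.exp (x + (-((τ - 2) * (μ * x)) - |C| * (μ ^ γ * x ^ γ))) := by
          refine mul_le_mul_of_nonneg_left (Real.exp_le_exp.2 ?_) (by positivity)
          have : ν * x = x - μ * (τ - 1) * x := by rw [hν]; ring
          linarith
      _ = _ := by rw [Real.exp_add]; ring
  · have h4 : Real.exp (μ * x) ^ 2 / (32 * ((β + 1) * Real.exp x))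
        = Real.exp ((2 * μ - 1) * x) / (32 * (β + 1)) := by
      have : Real.exp (μ * x) ^ 2 = Real.exp ((2 * μ - 1) * x) * Real.exp x := by
        rw [← Real.exp_add, ← Real.exp_nat_mul]; congr 1; push_cast; ring
      rw [this]; field_simp
    have h5 : 3 * x ≤ Real.exp ((2 * μ - 1) * x) / (32 * (β + 1)) := by
      rw [le_div_iff₀ (by positivity)]; linarith
    rw [h4, ← Real.exp_nat_mul, ← Real.exp_add, ← Real.le_log_iff_exp_le hη]
    push_cast
    linarith

/-- Truncating the exponents of the layers at the exponent `ℓ` of the hubs. -/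
theorem exists_truncated_exponents {s γ D A ℓ : ℝ} {a : ℕ → ℝ} (hs : 1 < s) (hγ : 0 < γ)
    (hD : 0 ≤ D) (hA : 0 < A) (hℓ : 2 * A < ℓ) (ha0 : a 0 = 2 * A) (ha : ∀ i, A * s ^ i ≤ a i)
    (hstep : ∀ i, D * a (i + 1) ^ γ ≤ a i - a (i + 1) / s) :
    ∃ (K : ℕ) (b : ℕ → ℝ), 1 ≤ K ∧ A * s ^ (K - 1) < ℓ ∧ b 0 = 2 * A ∧ b K = ℓ ∧
      (∀ i, b i ≤ ℓ) ∧ (∀ i, A ≤ b i) ∧ (∀ i < K, A * s ^ i ≤ b (i + 1)) ∧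
      ∀ i < K, D * b (i + 1) ^ γ ≤ b i - b (i + 1) / s := by
  classical
  have hs0 : 0 < s := by linarith
  have hex : ∃ i, ℓ ≤ a i := by
    obtain ⟨i, hi⟩ := pow_unbounded_of_one_lt (ℓ / A) hs
    rw [div_lt_iff₀ hA] at hi
    exact ⟨i, by linarith [ha i]⟩
  set K := Nat.find hex with hK
  have hKa : ℓ ≤ a K := Nat.find_spec hex
  have hlt : ∀ i < K, a i < ℓ := fun i hi => not_le.1 (Nat.find_min hex hi)
  have hK1 : 1 ≤ K := by
    by_contra h
    have h0 : K = 0 := by omega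
    rw [h0, ha0] at hKa
    linarith
  have hpow : ∀ i, A ≤ A * s ^ i := fun i => le_mul_of_one_le_right hA.le (one_le_pow₀ hs.le)
  have hsucc : ∀ i < K, A * s ^ i ≤ if i + 1 < K then a (i + 1) else ℓ := by
    intro i hi
    split_ifs
    · refine le_trans ?_ (ha (i + 1))
      gcongr
      · exact hs.le
      · omega
    · exact (ha i).trans (hlt i hi).le
  refine ⟨K, fun i => if i < K then a i else ℓ, hK1, (ha _).trans_lt (hlt _ (by omega)), ?_, ?_,
    ?_, ?_, hsucc, ?_⟩
  · simp only; rw [if_pos (by omega), ha0]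
  · simp
  · intro i
    simp only
    split_ifs with h
    · exact (hlt i h).le
    · exact le_rfl
  · intro i
    simp only
    split_ifs with h
    · exact (hpow i).trans (ha i)
    · linarith
  · intro i hi
    -- Truncation lowers only the upper exponent: this decreases the left side of the step
    -- inequality and increases the right side.
    have h1 : (if i + 1 < K then a (i + 1) else ℓ) ≤ a (i + 1) := by
      split_ifs with h
      · exact le_rfl
      · have : i + 1 = K := by omega
        rw [this]; exact hKa
    have h0 : 0 ≤ if i + 1 < K then a (i + 1) else ℓ :=
      (hA.le.trans (hpow i)).trans (hsucc i hi)
    simp only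
    rw [if_pos hi]
    generalize (if i + 1 < K then a (i + 1) else ℓ) = x at h0 h1
    calc D * x ^ γ ≤ D * a (i + 1) ^ γ := by gcongr
      _ ≤ a i - a (i + 1) / s := hstep i
      _ ≤ a i - x / s := by gcongr

theorem ceil_exp_div_four_ge {b : ℝ} (hb : 8 ≤ b) : Real.exp b / 8 ≤ (⌈Real.exp b⌉₊ / 4 : ℕ) := by
  have h1 : (8 : ℝ) ≤ Real.exp b := by linarith [Real.add_one_le_exp b]
  have h2 : Real.exp b ≤ ⌈Real.exp b⌉₊ := Nat.le_ceil _
  have h3 : 8 ≤ ⌈Real.exp b⌉₊ := by exact_mod_cast h1.trans h2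
  have h4 : (⌈Real.exp b⌉₊ : ℝ) ≤ 8 * (⌈Real.exp b⌉₊ / 4 : ℕ) := by exact_mod_cast (by omega)
  linarith

theorem ceil_exp_div_eight_ge {b : ℝ} (hb : 8 ≤ b) :
    Real.exp b / 16 ≤ (⌈Real.exp b⌉₊ / 8 : ℕ) := by
  have h1 : (8 : ℝ) ≤ Real.exp b := by linarith [Real.add_one_le_exp b]
  have h2 : Real.exp b ≤ ⌈Real.exp b⌉₊ := Nat.le_ceil _
  have h3 : 8 ≤ ⌈Real.exp b⌉₊ := by exact_mod_cast h1.trans h2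
  have h4 : (⌈Real.exp b⌉₊ : ℝ) ≤ 16 * (⌈Real.exp b⌉₊ / 8 : ℕ) := by exact_mod_cast (by omega)
  linarith

theorem two_mul_ceil_exp_div_four_le {b : ℝ} (hb : 0 ≤ b) :
    ((2 * (⌈Real.exp b⌉₊ / 4) : ℕ) : ℝ) ≤ Real.exp b := by
  have h1 : (1 : ℝ) ≤ Real.exp b := Real.one_le_exp hb
  have h2 := (Nat.ceil_lt_add_one (Real.exp_pos b).le).le
  have h4 : ((2 * (2 * (⌈Real.exp b⌉₊ / 4)) : ℕ) : ℝ) ≤ ⌈Real.exp b⌉₊ := by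
    exact_mod_cast (by omega)
  push_cast at h4 ⊢
  linarith

/-! ### Choice of parameters for admissible degrees -/

open Classical in
/-- For admissible degrees and large enough `k`, two vertices of degree at least `k` are close with
high probability over the pairing. -/
theorem exists_card_far_le {τ γ C c β x₀ α : ℝ} (hτ : τ ∈ Set.Ioo (2 : ℝ) 3)
    (hγ : γ ∈ Set.Ioo (0 : ℝ) 1) (hc : 0 < c) (hβ : 0 < β) (hx₀ : 0 < x₀) (hα : 1 / 2 < α)
    {ε : ℝ} (hε : 0 < ε) :
    ∃ k : ℕ, ∀ n : ℕ, 1 ≤ n → ∀ d : Fin n → ℕ, Admissible τ γ C c β x₀ α d →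
      ∀ u v, k ≤ d u → k ≤ d v →
      ∃ r : ℕ, (r : ℝ) < 1 + 2 * Real.log (Real.log n) / |Real.log (τ - 2)| ∧
        ((Finset.univ.filter fun σ : Matching (HalfEdge d) =>
          ¬ (graph (d := d) σ).edist u v ≤ (r : ℕ)).card : ℝ)
          ≤ ε * (Finset.univ : Finset (Matching (HalfEdge d))).card := by
  obtain ⟨hτ2, hτ3⟩ := hτ
  set s : ℝ := (τ - 2)⁻¹ with hs_def
  have hs : 1 < s := (one_lt_inv₀ (by linarith)).2 (by linarith)
  have hs0 : 0 < s := by linarith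
  have hlog : 0 < Real.log s := Real.log_pos hs
  have hlogτ : |Real.log (τ - 2)| = Real.log s := by
    rw [hs_def, Real.log_inv, abs_of_neg (Real.log_neg (by linarith) (by linarith))]
  -- The interval is nonempty because `τ < 3`. The bound `α` keeps hubs in the range of the tail
  -- hypothesis.
  obtain ⟨μ, hμ, hμ'⟩ : ∃ μ, 1 / 2 < μ ∧ μ < min α (1 / (τ - 1)) := by
    refine exists_between (lt_min hα ?_)
    rw [div_lt_div_iff₀ two_pos (by linarith)]; linarith
  obtain ⟨hμα, hμτ⟩ := lt_min_iff.1 hμ'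
  rw [lt_div_iff₀ (by linarith)] at hμτ
  have hμ1 : μ < 1 := by nlinarith
  have hη : 0 < ε / 3 := by positivity
  have hκ : 0 < c / (16 * (β + 1)) := by positivity
  -- In `D`, the term `|C|` covers either sign of `C`, and the 1 leaves a surplus of `b (i + 1) ^ γ`
  -- in the expected number of hits. The three lower bounds on `A` give thresholds of at least 8,
  -- the strict bound on `K`, and thresholds above `x₀`.
  obtain ⟨A, a, hAL, hA0, ha0, ha, hstep, hsum⟩ :=
    exists_layer_exponents (L := max 8 (max s (Real.log x₀))) (D := |C| + 1) hs hγ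
      (by positivity) hκ hη
  obtain ⟨hA8, hAs, hAx⟩ : 8 ≤ A ∧ s ≤ A ∧ Real.log x₀ ≤ A := by
    simpa only [max_le_iff] using hAL
  obtain ⟨n₀, hn₀⟩ := Filter.eventually_atTop.1
    (Real.tendsto_log_atTop.eventually (eventually_large (C := C) hγ hc hβ hs hη hμ hμτ A))
  -- The first term starts the climb. The second forces `n₀ ≤ n`, because a single degree is at most
  -- `β n`; small `n` thus need no treatment.
  refine ⟨max ⌈Real.exp (2 * A)⌉₊ (⌈β * n₀⌉₊ + 1), fun n hn d hd u v hu hv => ?_⟩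
  have hn0 : (0 : ℝ) < n := by exact_mod_cast hn
  have hn_ge : n₀ ≤ n := by
    have h1 : (⌈β * n₀⌉₊ + 1 : ℕ) ≤ ∑ w, d w := ((le_max_right _ _).trans hu).trans
      (Finset.single_le_sum (fun _ _ => Nat.zero_le _) (Finset.mem_univ u))
    have h2 : ((⌈β * n₀⌉₊ + 1 : ℕ) : ℝ) ≤ (∑ w, d w : ℕ) := by exact_mod_cast h1
    have h3 := hd.total_le
    have h4 := Nat.le_ceil (β * n₀)
    push_cast at h2 h3
    have h5 : β * n₀ ≤ β * n := by linarith
    exact le_of_mul_le_mul_left h5 hβ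
  obtain ⟨hℓ1, hℓA, hbudget, hhubs⟩ := hn₀ n hn_ge
  rw [Real.exp_log hn0] at hbudget hhubs
  set ℓ := Real.log n with hℓ
  obtain ⟨K, b, hK1, hKℓ, hb0, hbK, hbℓ, hbA, hbs, hbstep⟩ :=
    exists_truncated_exponents hs hγ.1 (by positivity) hA0 hℓA ha0 ha hstep
  have hKlog : (K : ℝ) < Real.log ℓ / Real.log s := by
    have h1 : s ^ K < ℓ := by
      obtain ⟨j, rfl⟩ : ∃ j, K = j + 1 := ⟨K - 1, by omega⟩
      rw [Nat.add_sub_cancel] at hKℓ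
      have h2 : s * s ^ j ≤ A * s ^ j := by gcongr
      have h3 : μ * ℓ ≤ 1 * ℓ := by gcongr
      rw [pow_succ']; linarith
    rw [lt_div_iff₀ hlog, ← Real.log_pow]
    exact Real.log_lt_log (by positivity) h1
  set m : ℕ → ℕ := fun i => ⌈Real.exp (b i)⌉₊ with hm
  -- Only half of each layer is credited to the success probability; the other half pays for the
  -- half-edges lost to exploration.
  set p : ℕ → ℝ := fun i => c / (2 * (β + 1)) * Real.exp (-((τ - 2) * b i) + C * b i ^ γ) with hp
  set Z : ℕ := ∑ j ∈ Finset.Ico 0 K, 2 * (m j / 4) with hZ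
  have hH := hd.card_halfEdge_le hn
  have hb8 : ∀ i, 8 ≤ b i := fun i => hA8.trans (hbA i)
  have hm8 : ∀ i, 8 ≤ m i := by
    intro i
    have h1 : (8 : ℝ) ≤ m i :=
      (by linarith [hb8 i, Real.add_one_le_exp (b i)] : 8 ≤ Real.exp (b i)).trans (Nat.le_ceil _)
    exact_mod_cast h1
  have hZle : 5 * (Z : ℝ) + 1 ≤ 6 * (Real.log ℓ / Real.log s) * Real.exp (μ * ℓ) := by
    have h1 : (Z : ℝ) ≤ K * Real.exp (μ * ℓ) := by
      rw [hZ]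
      push_cast only [Nat.cast_sum]
      refine (Finset.sum_le_card_nsmul _ _ (Real.exp (μ * ℓ)) fun j _ => ?_).trans (by simp)
      exact (two_mul_ceil_exp_div_four_le (by linarith [hb8 j])).trans
        (Real.exp_le_exp.2 (hbℓ j))
    have h2 : (1 : ℝ) ≤ K * Real.exp (μ * ℓ) :=
      one_le_mul_of_one_le_of_one_le (by exact_mod_cast hK1) (Real.one_le_exp (by nlinarith))
    have h3 : K * Real.exp (μ * ℓ) ≤ Real.log ℓ / Real.log s * Real.exp (μ * ℓ) := by gcongr
    linarith
  have hlayer : ∀ i, c * n * Real.exp (-((τ - 2) * b i) + C * b i ^ γ) ≤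
      (layerHalfEdges d (m i)).card := by
    intro i
    refine hd.card_layerHalfEdges_ge hn (by linarith [hb8 i]) ?_ ?_
    · rw [← Real.log_le_iff_le_exp hx₀]; exact hAx.trans (hbA i)
    · refine (hbℓ i).trans_lt ?_
      gcongr
  have htrial : ∀ i,
      p i * Fintype.card (HalfEdge d) + (5 * Z + 1) ≤ (layerHalfEdges d (m i)).card := by
    intro i
    have h1 : p i * Fintype.card (HalfEdge d) ≤
        c / 2 * n * Real.exp (-((τ - 2) * b i) + C * b i ^ γ) := by
      calc p i * Fintype.card (HalfEdge d) ≤ p i * ((β + 1) * n) := by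
            gcongr
        _ = _ := by simp only [hp]; field_simp
    have h2 : c / 2 * n * Real.exp (-((τ - 2) * (μ * ℓ)) - |C| * (μ * ℓ) ^ γ) ≤
        c / 2 * n * Real.exp (-((τ - 2) * b i) + C * b i ^ γ) := by
      refine mul_le_mul_of_nonneg_left (Real.exp_le_exp.2 ?_) (by positivity)
      have h3 : (τ - 2) * b i ≤ (τ - 2) * (μ * ℓ) :=
        mul_le_mul_of_nonneg_left (hbℓ i) (by linarith)
      have h4 : -C * b i ^ γ ≤ |C| * (μ * ℓ) ^ γ := by
        have hbi : 0 ≤ b i := by linarith [hb8 i]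
        calc -C * b i ^ γ ≤ |C| * b i ^ γ := by gcongr; exact neg_le_abs C
          _ ≤ _ := by
            gcongr
            · exact hγ.1.le
            · exact hbℓ i
      linarith
    have := hlayer i
    linarith
  have hp0 : ∀ i, 0 ≤ p i := fun i => by simp only [hp]; positivity
  have hHpos : (0 : ℝ) < Fintype.card (HalfEdge d) := by
    have h1 := htrial 0
    have h2 : ((layerHalfEdges d (m 0)).card : ℝ) ≤ Fintype.card (HalfEdge d) := by
      exact_mod_cast Finset.card_le_univ _
    have h3 : 0 ≤ p 0 * Fintype.card (HalfEdge d) := mul_nonneg (hp0 0) (by positivity)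
    have h4 : (0 : ℝ) ≤ Z := by positivity
    linarith
  -- No direct estimate is needed: a layer cannot exceed the total number of half-edges.
  have hp1 : ∀ i, p i ≤ 1 := by
    intro i
    have h1 := htrial i
    have h2 : ((layerHalfEdges d (m i)).card : ℝ) ≤ Fintype.card (HalfEdge d) := by
      exact_mod_cast Finset.card_le_univ _
    have h4 : (0 : ℝ) ≤ Z := by positivity
    have h5 : p i * Fintype.card (HalfEdge d) ≤ 1 * Fintype.card (HalfEdge d) := by linarith
    exact le_of_mul_le_mul_right h5 hHpos
  have hfail : ∑ j ∈ Finset.Ico 0 K, (1 - p (j + 1)) ^ (m j / 4) ≤ ε / 3 := by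
    refine le_trans ?_ (hsum K)
    rw [Finset.range_eq_Ico]
    refine Finset.sum_le_sum fun j hj => one_sub_pow_le_exp (hp1 _) ?_
    have hj' := (Finset.mem_Ico.1 hj).2
    have h1 : Real.exp (b j) / 8 ≤ (m j / 4 : ℕ) := ceil_exp_div_four_ge (hb8 j)
    have h2 : (A * s ^ j) ^ γ ≤ b (j + 1) ^ γ :=
      Real.rpow_le_rpow (by positivity) (hbs j hj') hγ.1.le
    have h3 : b (j + 1) ^ γ ≤ b j + (-((τ - 2) * b (j + 1)) + C * b (j + 1) ^ γ) := by
      have h4 := hbstep j hj'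
      rw [div_eq_mul_inv, hs_def, inv_inv] at h4
      have h5 : -C * b (j + 1) ^ γ ≤ |C| * b (j + 1) ^ γ :=
        mul_le_mul_of_nonneg_right (neg_le_abs C)
          (Real.rpow_nonneg (by linarith [hb8 (j + 1)]) _)
      linarith
    calc c / (16 * (β + 1)) * Real.exp ((A * s ^ j) ^ γ)
        ≤ c / (16 * (β + 1)) *
          Real.exp (b j + (-((τ - 2) * b (j + 1)) + C * b (j + 1) ^ γ)) :=
          mul_le_mul_of_nonneg_left (Real.exp_le_exp.2 (h2.trans h3)) hκ.le
      _ = p (j + 1) * (Real.exp (b j) / 8) := by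
          rw [Real.exp_add]; simp only [hp]; field_simp; ring
      _ ≤ _ := mul_le_mul_of_nonneg_left h1 (hp0 _)
  have hclimb : ∀ w, max ⌈Real.exp (2 * A)⌉₊ (⌈β * n₀⌉₊ + 1) ≤ d w →
      ((Finset.univ.filter fun σ : Matching (HalfEdge d) => ¬ NearHub σ (m K) K w).card : ℝ)
      ≤ ε / 3 * (Finset.univ : Finset (Matching (HalfEdge d))).card := by
    intro w hw
    refine (card_not_nearHub_le (m := m) (p := p) (K := K) (Z := Z) (fun i _ _ => hm8 i)
      (fun i _ _ => hp0 i) (fun i _ _ => hp1 i) (fun i _ _ => htrial i) K 0 (by omega) w ?_ ∅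
      Finset.univ isCylinder_univ (by simp) (by simp [hZ])).trans ?_
    · simp only [hm]; rw [hb0]; exact (le_max_left _ _).trans hw
    · gcongr
  have hMH : m K ≤ Fintype.card (HalfEdge d) := by
    have h1 : 0 < (layerHalfEdges d (m K)).card := by
      have h2 : (0 : ℝ) < (layerHalfEdges d (m K)).card :=
        lt_of_lt_of_le (by positivity) (hlayer K)
      exact_mod_cast h2
    obtain ⟨h, hh⟩ := Finset.card_pos.1 h1
    rw [← card_firstHalfEdges (mem_layerHalfEdges.1 hh).1]
    exact Finset.card_le_univ _
  have hMH' : (m K : ℝ) ≤ Fintype.card (HalfEdge d) := by exact_mod_cast hMH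
  have hhub : (n : ℝ) ^ 2 * (1 - m K / (2 * Fintype.card (HalfEdge d))) ^ (m K / 8) ≤ ε / 3 := by
    refine le_trans (mul_le_mul_of_nonneg_left (one_sub_pow_le_exp ?_ ?_) (by positivity)) hhubs
    · rw [div_le_one (by positivity)]; linarith
    · have h1 : Real.exp (μ * ℓ) / 16 ≤ (m K / 8 : ℕ) := by
        simp only [hm]; rw [← hbK]; exact ceil_exp_div_eight_ge (hb8 K)
      have h2 : Real.exp (μ * ℓ) ≤ m K := by
        simp only [hm]; rw [← hbK]; exact Nat.le_ceil _
      calc Real.exp (μ * ℓ) ^ 2 / (32 * ((β + 1) * n))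
          = Real.exp (μ * ℓ) / (2 * ((β + 1) * n)) * (Real.exp (μ * ℓ) / 16) := by
            field_simp; ring
        _ ≤ m K / (2 * Fintype.card (HalfEdge d)) * (m K / 8 : ℕ) := by gcongr
  refine ⟨2 * K + 1, ?_, (card_far_le (by linarith [hm8 K]) (hclimb u hu) (hclimb v hv)
    (by linarith)).trans ?_⟩
  · rw [hlogτ, mul_div_assoc]; push_cast; linarith
  · gcongr
    linarith

/-! ### From counting matchings to conditional probabilities -/

instance {n : ℕ} (d : Fin n → ℕ) : DiscreteMeasurableSpace (Pairing d) :=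
  ⟨fun _ => MeasurableSpace.measurableSet_top⟩

noncomputable instance {n : ℕ} (d : Fin n → ℕ) : Fintype (Pairing d) :=
  inferInstanceAs (Fintype (Matching (HalfEdge d)))

open Classical in
theorem cond_law_le {S E : Set (Sample d)} {δ : ℝ}
    (h : ((Finset.univ.filter fun ω => ω ∈ S ∧ ω ∈ E).card : ℝ)
      ≤ δ * (Finset.univ.filter fun ω => ω ∈ S).card) :
    ProbabilityTheory.cond (law d) S E ≤ ENNReal.ofReal δ := by
  have hfin : ∀ X : Set (Sample d), MeasureTheory.Measure.count X
      = ENNReal.ofReal ((Finset.univ.filter fun ω => ω ∈ X).card : ℝ) := by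
    intro X
    rw [ENNReal.ofReal_natCast, ← MeasureTheory.Measure.count_apply_finset]
    congr 1
    ext ω
    simp
  have hmeas : ∀ X : Set (Sample d), MeasurableSet X := fun X => X.toFinite.measurableSet
  have hlaw : ProbabilityTheory.cond (law d) S = ProbabilityTheory.uniformOn S := by
    unfold law ProbabilityTheory.uniformOn
    rw [ProbabilityTheory.cond_cond_eq_cond_inter' (hmeas _) (hmeas _) ?_, Set.univ_inter]
    rw [hfin]; exact ENNReal.ofReal_ne_top
  rw [hlaw]
  unfold ProbabilityTheory.uniformOn
  rw [ProbabilityTheory.cond_apply (hmeas S), hfin, hfin]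
  simp only [Set.mem_inter_iff]
  rcases (Nat.cast_nonneg (α := ℝ) (Finset.univ.filter fun ω => ω ∈ S).card).eq_or_lt with h0 | h0
  · rw [← h0, mul_zero] at h
    rw [ENNReal.ofReal_of_nonpos h, mul_zero]
    exact zero_le
  · rw [← ENNReal.ofReal_inv_of_pos h0, ← ENNReal.ofReal_mul (by positivity)]
    refine ENNReal.ofReal_le_ofReal ?_
    rw [inv_mul_le_iff₀ h0, mul_comm]
    exact h

theorem not_edist_le_of_mem_farApart {τ : ℝ} {ω : Sample d} {r : ℕ}
    (hr : (r : ℝ) < 1 + 2 * Real.log (Real.log n) / |Real.log (τ - 2)|)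
    (hω : ω ∈ farApart d τ) : ¬ (graph ω.1).edist ω.2.1 ω.2.2 ≤ r := by
  intro hle
  have hω' : (((graphDist ω : ℕ∞) : ℝ≥0∞) : EReal)
      - ((2 * Real.log (Real.log n) / |Real.log (τ - 2)| : ℝ) : EReal) ≥ 1 := hω
  obtain ⟨j, hj⟩ : ∃ j : ℕ, graphDist ω = j :=
    ⟨_, (ENat.natCast_toNat (ne_top_of_le_ne_top (ENat.natCast_ne_top r) hle)).symm⟩
  have hjr : j ≤ r := by
    have : (j : ℕ∞) ≤ r := hj ▸ hle
    exact_mod_cast this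
  rw [hj] at hω'
  have h1 : (((j : ℕ∞) : ℝ≥0∞) : EReal) = ((j : ℝ) : EReal) := by
    rw [ENat.toENNReal_coe]
    rfl
  rw [h1, ← EReal.coe_sub, ge_iff_le, ← EReal.coe_one, EReal.coe_le_coe_iff] at hω'
  have : (j : ℝ) ≤ r := by exact_mod_cast hjr
  linarith

theorem mem_farApart_of_notMem_sameComponent {τ : ℝ} {ω : Sample d}
    (hω : ω ∉ sameComponent d) : ω ∈ farApart d τ := by
  have h : graphDist ω = ⊤ := SimpleGraph.edist_eq_top_of_not_reachable hω
  change (((graphDist ω : ℕ∞) : ℝ≥0∞) : EReal)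
      - ((2 * Real.log (Real.log n) / |Real.log (τ - 2)| : ℝ) : EReal) ≥ 1
  rw [h]
  simp

-- The degree condition depends on the endpoints only, so the bound for each fixed pair can be
-- summed over pairs.
open Classical in
theorem card_farApart_le {τ δ : ℝ} {k : ℕ}
    (h : ∀ u v, k ≤ d u → k ≤ d v →
      ∃ r : ℕ, (r : ℝ) < 1 + 2 * Real.log (Real.log n) / |Real.log (τ - 2)| ∧
        ((Finset.univ.filter fun σ : Matching (HalfEdge d) =>
          ¬ (graph (d := d) σ).edist u v ≤ (r : ℕ)).card : ℝ)
          ≤ δ * (Finset.univ : Finset (Matching (HalfEdge d))).card) :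
    ((Finset.univ.filter fun ω => ω ∈ highDegrees d k ∧ ω ∈ farApart d τ).card : ℝ)
      ≤ δ * (Finset.univ.filter fun ω => ω ∈ highDegrees d k).card := by
  have hfib (X : Sample d → Prop) [DecidablePred X] : (Finset.univ.filter X).card =
      ∑ x : Fin n × Fin n, (Finset.univ.filter fun σ : Pairing d => X (σ, x)).card := by
    rw [Finset.card_eq_sum_card_fiberwise (f := fun ω : Sample d => ω.2) (t := Finset.univ)
      (fun _ _ => Finset.mem_coe.2 (Finset.mem_univ _))]
    refine Finset.sum_congr rfl fun x _ => ?_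
    refine Finset.card_bij' (fun ω _ => ω.1) (fun σ _ => (σ, x)) ?_ ?_ ?_ ?_
    · rintro ⟨σ, y⟩ hω
      simp only [Finset.mem_filter, Finset.mem_univ, true_and] at hω ⊢
      obtain ⟨hX, rfl⟩ := hω
      exact hX
    · intro σ hσ
      simpa using hσ
    · rintro ⟨σ, y⟩ hω
      simp only [Finset.mem_filter, Finset.mem_univ, true_and] at hω ⊢
      rw [hω.2]
    · intro σ _
      rfl
  rw [hfib, hfib]
  push_cast
  rw [Finset.mul_sum]
  refine Finset.sum_le_sum fun x _ => ?_
  by_cases hx : k ≤ d x.1 ∧ k ≤ d x.2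
  · obtain ⟨r, hr, hcard⟩ := h x.1 x.2 hx.1 hx.2
    have h1 : (Finset.univ.filter fun σ : Pairing d => (σ, x) ∈ highDegrees d k)
        = Finset.univ := Finset.filter_true_of_mem fun σ _ => hx
    rw [h1]
    refine le_trans ?_ hcard
    have h2 : (Finset.univ.filter fun σ : Pairing d =>
        (σ, x) ∈ highDegrees d k ∧ (σ, x) ∈ farApart d τ).card ≤
        (Finset.univ.filter fun σ : Matching (HalfEdge d) =>
          ¬ (graph (d := d) σ).edist x.1 x.2 ≤ (r : ℕ)).card := by
      refine Finset.card_le_card fun σ hσ => ?_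
      have hσ' := (Finset.mem_filter.1 hσ).2
      exact Finset.mem_filter.2 ⟨Finset.mem_univ _, not_edist_le_of_mem_farApart hr hσ'.2⟩
    exact_mod_cast h2
  · have h1 : ∀ Y : Pairing d → Prop, (Finset.univ.filter fun σ : Pairing d =>
        (σ, x) ∈ highDegrees d k ∧ Y σ) = ∅ := fun Y =>
      Finset.filter_false_of_mem fun σ _ hσ => hx hσ.1
    have h2 : (Finset.univ.filter fun σ : Pairing d => (σ, x) ∈ highDegrees d k) = ∅ :=
      Finset.filter_false_of_mem fun σ _ hσ => hx hσ
    rw [h1, h2]; simp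

-- Pairs in different components are at infinite distance, hence far apart. With `δ ≤ 1 / 2`, at
-- least half of `S` therefore remains after conditioning, and the ratio at most doubles.
open Classical in
theorem card_sameComponent_farApart_le {τ δ : ℝ} {S S' : Set (Sample d)}
    (hS' : S' = S ∩ sameComponent d) (hδ : δ ≤ 1 / 2)
    (h : ((Finset.univ.filter fun ω => ω ∈ S ∧ ω ∈ farApart d τ).card : ℝ)
      ≤ δ * (Finset.univ.filter fun ω => ω ∈ S).card) (hδ0 : 0 ≤ δ) :
    ((Finset.univ.filter fun ω => ω ∈ S' ∧ ω ∈ farApart d τ).card : ℝ)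
      ≤ 2 * δ * (Finset.univ.filter fun ω => ω ∈ S').card := by
  have h1 : (Finset.univ.filter fun ω => ω ∈ S' ∧ ω ∈ farApart d τ).card ≤
      (Finset.univ.filter fun ω => ω ∈ S ∧ ω ∈ farApart d τ).card := by
    refine Finset.card_le_card fun ω hω => ?_
    have := (Finset.mem_filter.1 hω).2
    rw [hS'] at this
    exact Finset.mem_filter.2 ⟨Finset.mem_univ _, this.1.1, this.2⟩
  have h2 : (Finset.univ.filter fun ω => ω ∈ S).card ≤
      (Finset.univ.filter fun ω => ω ∈ S').card +
      (Finset.univ.filter fun ω => ω ∈ S ∧ ω ∈ farApart d τ).card := by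
    refine le_trans (Finset.card_le_card fun ω hω => ?_) (Finset.card_union_le _ _)
    have hS := (Finset.mem_filter.1 hω).2
    rw [Finset.mem_union, Finset.mem_filter, Finset.mem_filter]
    by_cases hc : ω ∈ sameComponent d
    · exact Or.inl ⟨Finset.mem_univ _, hS' ▸ ⟨hS, hc⟩⟩
    · exact Or.inr ⟨Finset.mem_univ _, hS, mem_farApart_of_notMem_sameComponent hc⟩
  have h1' : ((Finset.univ.filter fun ω => ω ∈ S' ∧ ω ∈ farApart d τ).card : ℝ) ≤
      (Finset.univ.filter fun ω => ω ∈ S ∧ ω ∈ farApart d τ).card := by exact_mod_cast h1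
  have h2' : ((Finset.univ.filter fun ω => ω ∈ S).card : ℝ) ≤
      (Finset.univ.filter fun ω => ω ∈ S').card +
      (Finset.univ.filter fun ω => ω ∈ S ∧ ω ∈ farApart d τ).card := by exact_mod_cast h2
  have h3 : δ * ((Finset.univ.filter fun ω => ω ∈ S).card : ℝ) ≤
      1 / 2 * (Finset.univ.filter fun ω => ω ∈ S).card := by gcongr
  have h4 : ((Finset.univ.filter fun ω => ω ∈ S).card : ℝ) ≤
      2 * (Finset.univ.filter fun ω => ω ∈ S').card := by linarith
  calc _ ≤ _ := h1'
    _ ≤ _ := h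
    _ ≤ δ * (2 * (Finset.univ.filter fun ω => ω ∈ S').card) := by gcongr
    _ = _ := by ring

end ConfigurationModel

theorem proposition2p1 (τ γ C c β x₀ α : ℝ) (hτ : τ ∈ Set.Ioo (2 : ℝ) 3)
    (hγ : γ ∈ Set.Ioo (0 : ℝ) 1) (hc : 0 < c) (hβ : 0 < β) (hx₀ : 0 < x₀) (hα : 1 / 2 < α) :
    ∀ ε : ℝ, 0 < ε → ∃ k : ℕ,
      (⨆ (n : ℕ) (_ : 1 ≤ n) (d : Fin n → ℕ)
          (_ : ConfigurationModel.Admissible τ γ C c β x₀ α d),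
        ProbabilityTheory.cond (ConfigurationModel.law d)
          (ConfigurationModel.highDegrees d k)
          (ConfigurationModel.farApart d τ)) < ENNReal.ofReal ε ∧
      (⨆ (n : ℕ) (_ : 1 ≤ n) (d : Fin n → ℕ)
          (_ : ConfigurationModel.Admissible τ γ C c β x₀ α d),
        ProbabilityTheory.cond (ConfigurationModel.law d)
          (ConfigurationModel.highDegrees d k ∩ ConfigurationModel.sameComponent d)
          (ConfigurationModel.farApart d τ)) < ENNReal.ofReal ε := by
  intro ε hε
  -- Room for the doubling, and for a strict inequality after taking suprema.
  have hδ : 0 < min (ε / 4) (1 / 2) := by positivity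
  have hδε : 2 * min (ε / 4) (1 / 2) < ε := by linarith [min_le_left (ε / 4) (1 / 2)]
  obtain ⟨k, hk⟩ := ConfigurationModel.exists_card_far_le (C := C) hτ hγ hc hβ hx₀ hα hδ
  refine ⟨k, ?_, ?_⟩
  · refine lt_of_le_of_lt (iSup_le fun n => iSup_le fun hn => iSup_le fun d => iSup_le fun hd =>
      ConfigurationModel.cond_law_le (ConfigurationModel.card_farApart_le (hk n hn d hd)))
      ((ENNReal.ofReal_lt_ofReal_iff hε).2 (by linarith))
  · refine lt_of_le_of_lt (iSup_le fun n => iSup_le fun hn => iSup_le fun d => iSup_le fun hd =>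
      ConfigurationModel.cond_law_le (ConfigurationModel.card_sameComponent_farApart_le rfl
        (min_le_right _ _) (ConfigurationModel.card_farApart_le (hk n hn d hd)) hδ.le))
      ((ENNReal.ofReal_lt_ofReal_iff hε).2 hδε)
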